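/- Let $\varphi:\mathbb{R}^n\to\overline{\mathbb{R}}$ be lower semicontinuous and prox-bounded, i.e. for some $\lambda>0$ and some $x$ one has $e_\lambda\varphi(x)>-\infty$, where $e_\lambda\varphi(x):=\inf_{y\in\mathbb{R}^n}\{\varphi(y)+\frac{1}{2\lambda}\|y-x\|^2\}$ is the Moreau envelope. Let $\varphi(\bar x)<\infty$ and $\bar v\in\partial\varphi(\bar x)$. Here, for $f:\mathbb{R}^n\to\overline{\mathbb{R}}$ and $x$ with $f(x)$ finite, $\widehat\partial f(x)$ is the set of all $v$ with $\liminf_{y\to x,\,y\neq x}\frac{f(y)-f(x)-\langle v,y-x\rangle}{\|y-x\|}\ge 0$, and $\partial f(x)$ is the set of all limits $v=\lim v_k$ with $v_k\in\widehat\partial f(x_k)$, $x_k\to x$, $f(x_k)\to f(x)$; both sets are empty where $f(x)$ is not finite. Then the following assertions are equivalent: (i) $\varphi$ is variationally convex at $\bar x$ for $\bar v$: there are open convex neighborhoods $U$ of $\bar x$ and $V$ of $\bar v$, a lower semicontinuous convex function $\psi:U\to(-\infty,\infty]$ with $\psi\le\varphi$ on $U$, and $\varepsilon>0$ such that, with $U_\varepsilon:=\{x\in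 U\mid\varphi(x)<\varphi(\bar x)+\varepsilon\}$, one has $(U_\varepsilon\times V)\cap\operatorname{gph}\partial\varphi=(U\times V)\cap\operatorname{gph}\partial\psi$, and $\varphi(x)=\psi(x)$ at the common elements $(x,v)$. (ii) $\varphi$ is prox-regular at $\bar x$ for $\bar v$, i.e. there are $\varepsilon>0$ and $r\ge0$ such that $\varphi(x)\ge\varphi(u)+\langle v,x-u\rangle-\frac r2\|x-u\|^2$ whenever $\|x-\bar x\|\le\varepsilon$, $\|u-\bar x\|\le\varepsilon$, $\|v-\bar v\|\le\varepsilon$, $v\in\partial\varphi(u)$ and $\varphi(u)<\varphi(\bar x)+\varepsilon$; and there is $\lambda_0>0$ such that for every $\lambda\in(0,\lambda_0)$ the Moreau envelope $e_\lambda\varphi$ is convex on some convex neighborhood of $\bar x+\lambda\bar v$. -/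

import Mathlib

open Filter Topology

noncomputable section

/-- The Euclidean space of dimension `n`. -/
abbrev RSpace (n : ℕ) : Type := EuclideanSpace ℝ (Fin n)

/-- The (Fréchet) regular subdifferential of `φ` at `x`:
all `v` with `liminf_{y → x, y ≠ x} (φ y - φ x - ⟪v, y - x⟫) / ‖y - x‖ ≥ 0`.
It is empty where `φ x` is not finite. -/
def regularSubdifferential {n : ℕ} (φ : RSpace n → EReal) (x : RSpace n) : Set (RSpace n) :=
  {v | φ x ≠ ⊤ ∧ φ x ≠ ⊥ ∧
    0 ≤ liminf (fun y : RSpace n =>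
      (φ y - φ x - ((inner ℝ v (y - x) : ℝ) : EReal)) / ((‖y - x‖ : ℝ) : EReal)) (𝓝[≠] x)}

/-- The (Mordukhovich) limiting subdifferential of `φ` at `x`: all limits of regular subgradients
`v k` of `φ` at points `u k` with `u k → x` and `φ (u k) → φ x`.
It is empty where `φ x` is not finite. -/
def limitingSubdifferential {n : ℕ} (φ : RSpace n → EReal) (x : RSpace n) : Set (RSpace n) :=
  {v | φ x ≠ ⊤ ∧ φ x ≠ ⊥ ∧
    ∃ (u w : ℕ → RSpace n),
      Tendsto u atTop (𝓝 x) ∧ Tendsto (fun k => φ (u k)) atTop (𝓝 (φ x)) ∧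
      Tendsto w atTop (𝓝 v) ∧ ∀ k, w k ∈ regularSubdifferential φ (u k)}

/-- Convexity of an extended-real-valued function on a convex set. It is used for functions
that do not take both values `⊤` and `⊥` on `U`. -/
def IsConvexFunOn {n : ℕ} (f : RSpace n → EReal) (U : Set (RSpace n)) : Prop :=
  Convex ℝ U ∧ ∀ x ∈ U, ∀ y ∈ U, ∀ t : ℝ, 0 ≤ t → t ≤ 1 →
    f ((1 - t) • x + t • y) ≤ ((1 - t : ℝ) : EReal) * f x + (t : EReal) * f y

/-- Local convexity around `x`: convexity on some (convex) neighborhood of `x`. -/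
def IsLocallyConvexAround {n : ℕ} (f : RSpace n → EReal) (x : RSpace n) : Prop :=
  ∃ U ∈ 𝓝 x, IsConvexFunOn f U

/-- The Moreau envelope `e_λ φ (x) = inf_y (φ y + ‖y - x‖² / (2 λ))`. -/
def moreauEnvelope {n : ℕ} (lam : ℝ) (φ : RSpace n → EReal) (x : RSpace n) : EReal :=
  ⨅ y : RSpace n, φ y + ((1 / (2 * lam) * ‖y - x‖ ^ 2 : ℝ) : EReal)

/-- Prox-boundedness: `e_λ φ (x) > -∞` for some `λ > 0` and some `x`. -/
def IsProxBounded {n : ℕ} (φ : RSpace n → EReal) : Prop :=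
  ∃ lam : ℝ, 0 < lam ∧ ∃ x : RSpace n, ⊥ < moreauEnvelope lam φ x

/-- Prox-regularity of an l.s.c. function `φ` at a point `xbar` of its domain for a limiting
subgradient `vbar` of `φ` at `xbar`. -/
def IsProxRegularAt {n : ℕ} (φ : RSpace n → EReal) (xbar vbar : RSpace n) : Prop :=
  ∃ ε r : ℝ, 0 < ε ∧ 0 ≤ r ∧
    ∀ x ∈ Metric.closedBall xbar ε, ∀ u ∈ Metric.closedBall xbar ε,
      ∀ v ∈ Metric.closedBall vbar ε,
        v ∈ limitingSubdifferential φ u → φ u < φ xbar + (ε : EReal) →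
          φ u + ((inner ℝ v (x - u) - r / 2 * ‖x - u‖ ^ 2 : ℝ) : EReal) ≤ φ x

/-- Variational convexity of an l.s.c. function `φ` at a point `xbar` of its domain for a limiting
subgradient `vbar` of `φ` at `xbar`. The function `ψ : U → (-∞, ∞]` is given by its values
on the open set `U`; its limiting subdifferential at the points of `U` depends on these only. -/
def IsVariationallyConvexAt {n : ℕ} (φ : RSpace n → EReal) (xbar vbar : RSpace n) : Prop :=
  ∃ U V : Set (RSpace n),
    IsOpen U ∧ Convex ℝ U ∧ xbar ∈ U ∧ IsOpen V ∧ Convex ℝ V ∧ vbar ∈ V ∧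
    ∃ (ψ : RSpace n → EReal) (ε : ℝ), 0 < ε ∧
      (∀ x ∈ U, ψ x ≠ ⊥) ∧ LowerSemicontinuousOn ψ U ∧ IsConvexFunOn ψ U ∧
      (∀ x ∈ U, ψ x ≤ φ x) ∧
      (∀ x ∈ U, ∀ v ∈ V,
        (φ x < φ xbar + (ε : EReal) ∧ v ∈ limitingSubdifferential φ x) ↔
          v ∈ limitingSubdifferential ψ x) ∧
      (∀ x ∈ U, ∀ v ∈ V, v ∈ limitingSubdifferential ψ x → φ x = ψ x)

end

/-! Both assertions are equivalent to `HasLocalSubgradientInequality`: near `(xbar, vbar)`, limiting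
subgradients of `φ` at points of low value are affine supports of `φ` on a ball.

Variational convexity gives this at once: the subgradients of `φ` concerned are subgradients of the
convex minorant `ψ`, which agrees with `φ` at their base points.

The passage to and from envelopes rests on proximal points. Prox-boundedness upgrades the local
inequality to a global quadratic one (`exists_global_inequality`). For small `lam`, each `w` near
`xbar + lam • vbar` is then `q + lam • v` with `v` a subgradient at `q` close to `vbar` and `q` a
minimizer defining the envelope at `w` (`exists_prox_point`). So `v` is the natural candidate for a
subgradient of the envelope at `q + lam • v`, and supporting inequalities for `φ` and for its
envelope translate into each other.

To recover variational convexity, `ψ` is the supremum of all affine supports from the localized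
graph of `∂φ`. It could a priori have additional subgradients; a Minty-type argument excludes them,
since the localized graph already fills a neighborhood under `(q, v) ↦ q + lam • v` and `∂ψ` is
monotone. -/

/-! ### Regular and limiting subgradients. -/

theorem mem_regularSubdifferential_iff {n : ℕ} {φ : RSpace n → EReal} {x v : RSpace n} {a : ℝ}
    (ha : φ x = a) :
    v ∈ regularSubdifferential φ x ↔
      ∀ η : ℝ, 0 < η → ∀ᶠ y in 𝓝 x,
        ((a + inner ℝ v (y - x) - η * ‖y - x‖ : ℝ) : EReal) ≤ φ y := by
  have key : ∀ y : RSpace n, y ≠ x → ∀ c : ℝ,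
      (((c : ℝ) : EReal) ≤ (φ y - φ x - ((inner ℝ v (y - x) : ℝ) : EReal)) / ((‖y - x‖ : ℝ) : EReal)
        ↔ ((a + inner ℝ v (y - x) + c * ‖y - x‖ : ℝ) : EReal) ≤ φ y) := by
    intro y hy c
    have hpos : 0 < ‖y - x‖ := norm_pos_iff.2 (sub_ne_zero.2 hy)
    rw [EReal.le_div_iff_mul_le (by exact_mod_cast hpos) (EReal.coe_ne_top _), ha]
    induction hφ : φ y with
    | bot => simp [← EReal.coe_mul]
    | top => simp
    | coe b =>
      norm_cast
      constructor <;> intro h <;> linarith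
  have hfin : φ x ≠ ⊤ ∧ φ x ≠ ⊥ := by simp [ha]
  simp only [regularSubdifferential, Set.mem_ofPred_eq, hfin.1, hfin.2, ne_eq, not_false_eq_true,
    true_and]
  rw [le_liminf_iff]
  constructor
  · intro h η hη
    have h1 := h ((-η : ℝ) : EReal) (by exact_mod_cast neg_lt_zero.2 hη)
    rw [eventually_nhdsWithin_iff] at h1
    filter_upwards [h1] with y hy
    by_cases hyx : y = x
    · subst hyx; simp [ha]
    · have := (key y hyx (-η)).1 (hy hyx).le
      rwa [show a + inner ℝ v (y - x) - η * ‖y - x‖ = a + inner ℝ v (y - x) + -η * ‖y - x‖ by ring]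
  · intro h c hc
    obtain ⟨d, hcd, hd⟩ := EReal.lt_iff_exists_real_btwn.1 hc
    have hd' : d < 0 := by exact_mod_cast hd
    rw [eventually_nhdsWithin_iff]
    filter_upwards [h (-d) (by linarith)] with y hy hyx
    refine hcd.trans_le ((key y hyx d).2 ?_)
    rwa [show a + inner ℝ v (y - x) + d * ‖y - x‖ = a + inner ℝ v (y - x) - -d * ‖y - x‖ by ring]

theorem mem_regularSubdifferential_of_quadratic {n : ℕ} {φ : RSpace n → EReal} {x v : RSpace n}
    {a c : ℝ} (ha : φ x = a)
    (h : ∀ y, ((a + inner ℝ v (y - x) - c * ‖y - x‖ ^ 2 : ℝ) : EReal) ≤ φ y) :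
    v ∈ regularSubdifferential φ x := by
  rw [mem_regularSubdifferential_iff ha]
  intro η hη
  have h1 : Tendsto (fun y : RSpace n => c * ‖y - x‖) (𝓝 x) (𝓝 0) := by
    have : Continuous fun y : RSpace n => c * ‖y - x‖ := by fun_prop
    simpa using this.tendsto x
  filter_upwards [h1.eventually (gt_mem_nhds hη)] with y hy
  refine le_trans (EReal.coe_le_coe_iff.2 ?_) (h y)
  nlinarith [norm_nonneg (y - x)]

theorem regularSubdifferential_subset_limitingSubdifferential {n : ℕ} (φ : RSpace n → EReal)
    (x : RSpace n) : regularSubdifferential φ x ⊆ limitingSubdifferential φ x := fun v hv =>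
  ⟨hv.1, hv.2.1, fun _ => x, fun _ => v, tendsto_const_nhds, tendsto_const_nhds,
    tendsto_const_nhds, fun _ => hv⟩

/-! ### Subgradients of convex functions. -/

/-- On the segment from `x` to `y`, the first-order lower bound at parameter `t` meets the upper
bound from convexity; dividing by `t` leaves an arbitrarily small error. -/
theorem IsConvexFunOn.le_of_mem_regularSubdifferential {n : ℕ} {ψ : RSpace n → EReal}
    {U : Set (RSpace n)} {x v y : RSpace n} {a b : ℝ} (hψ : IsConvexFunOn ψ U) (hx : x ∈ U)
    (hv : v ∈ regularSubdifferential ψ x) (hy : y ∈ U) (ha : ψ x = a) (hb : ψ y = b) :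
    a + inner ℝ v (y - x) ≤ b := by
  refine le_of_forall_pos_le_add fun ε hε => ?_
  have hη : 0 < ε / (‖y - x‖ + 1) := by positivity
  have h1 := (mem_regularSubdifferential_iff ha).1 hv _ hη
  have h2 : Tendsto (fun t : ℝ => (1 - t) • x + t • y) (𝓝[>] 0) (𝓝 x) := by
    have : Continuous fun t : ℝ => (1 - t) • x + t • y := by fun_prop
    have := this.tendsto 0
    simp only [sub_zero, one_smul, zero_smul, add_zero] at this
    exact this.mono_left nhdsWithin_le_nhds
  have h3 : ∀ᶠ t : ℝ in 𝓝[>] 0, t ∈ Set.Ioo (0 : ℝ) 1 := Ioo_mem_nhdsGT one_pos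
  obtain ⟨t, ht, ht0, ht1⟩ := ((h2.eventually h1).and h3).exists
  have h4 := ht.trans (hψ.2 x hx y hy t ht0.le ht1.le)
  rw [show (1 - t) • x + t • y - x = t • (y - x) by module, ha, hb] at h4
  rw [inner_smul_right, norm_smul, Real.norm_of_nonneg ht0.le] at h4
  norm_cast at h4
  have h5 : ε / (‖y - x‖ + 1) * ‖y - x‖ ≤ ε := by
    rw [div_mul_eq_mul_div, div_le_iff₀ (by positivity)]
    nlinarith [norm_nonneg (y - x)]
  have h6 : t * (inner ℝ v (y - x) + a - b - ε / (‖y - x‖ + 1) * ‖y - x‖) ≤ 0 := by linarith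
  have h7 := nonpos_of_mul_nonpos_right h6 ht0
  linarith

theorem IsConvexFunOn.le_of_mem_limitingSubdifferential {n : ℕ} {ψ : RSpace n → EReal}
    {U : Set (RSpace n)} {x v y : RSpace n} (hψ : IsConvexFunOn ψ U) (hU : IsOpen U) (hx : x ∈ U)
    (hv : v ∈ limitingSubdifferential ψ x) (hy : y ∈ U) (hyb : ψ y ≠ ⊥) :
    ψ x + ((inner ℝ v (y - x) : ℝ) : EReal) ≤ ψ y := by
  obtain ⟨h1, h2, u, w, hu, hψu, hw, hreg⟩ := hv
  induction hb : ψ y with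
  | bot => exact absurd hb hyb
  | top => exact le_top
  | coe b =>
    have hlim := (EReal.tendsto_toReal h1 h2).comp hψu
    have hin : Tendsto (fun k => (inner ℝ (w k) (y - u k) : ℝ)) atTop (𝓝 (inner ℝ v (y - x))) :=
      hw.inner (tendsto_const_nhds.sub hu)
    have h3 : (ψ x).toReal + inner ℝ v (y - x) ≤ b := by
      refine le_of_tendsto (hlim.add hin) ?_
      filter_upwards [hu.eventually (hU.mem_nhds hx)] with k hk
      exact hψ.le_of_mem_regularSubdifferential hk (hreg k) hy
        (EReal.coe_toReal (hreg k).1 (hreg k).2.1).symm hb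
    rw [← EReal.coe_toReal h1 h2]
    exact_mod_cast h3

/-- A convex function lying below a quadratic function that touches it at `w`
has the gradient of this function at `w` as a subgradient. -/
theorem IsConvexFunOn.le_of_quadratic_majorant {n : ℕ} {f : RSpace n → EReal}
    {W : Set (RSpace n)} {w w' v : RSpace n} {a c : ℝ} (hf : IsConvexFunOn f W)
    (hW : W ∈ 𝓝 w) (hw' : w' ∈ W) (ha : f w = a)
    (h : ∀ y, f y ≤ ((a + inner ℝ v (y - w) + c * ‖y - w‖ ^ 2 : ℝ) : EReal)) :
    ((a + inner ℝ v (w' - w) : ℝ) : EReal) ≤ f w' := by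
  have h2 : Tendsto (fun t : ℝ => w - t • (w' - w)) (𝓝[>] 0) (𝓝 w) := by
    have : Continuous fun t : ℝ => w - t • (w' - w) := by fun_prop
    have := this.tendsto 0
    simp only [zero_smul, sub_zero] at this
    exact this.mono_left nhdsWithin_le_nhds
  have h3 : ∀ᶠ t : ℝ in 𝓝[>] 0, 0 < t := self_mem_nhdsWithin
  -- The point `w` lies between `w - t • (w' - w)` and `w'`, with weights `1 / (1 + t)` and `t / (1
  -- + t)`. Bounding `f` at the reflected point by the majorant bounds `f w'` from below, up to an
  -- error of order `t`.
  have h4 : ∀ᶠ t : ℝ in 𝓝[>] 0, (a : EReal) ≤ ((1 / (1 + t) *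
      (a - t * inner ℝ v (w' - w) + c * (t * ‖w' - w‖) ^ 2) : ℝ) : EReal) +
        ((t / (1 + t) : ℝ) : EReal) * f w' := by
    filter_upwards [h2.eventually_mem hW, h3] with t ht ht0
    have hs : 0 < 1 + t := by linarith
    have h5 := hf.2 _ ht w' hw' (t / (1 + t)) (by positivity) (by rw [div_le_one hs]; linarith)
    have e1 : 1 - t / (1 + t) = 1 / (1 + t) := by field_simp; ring
    have hpt : (1 / (1 + t)) • (w - t • (w' - w)) + (t / (1 + t)) • w' = w := by
      have e2 : w = (1 / (1 + t)) • ((1 + t) • w) := by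
        rw [smul_smul, one_div, inv_mul_cancel₀ hs.ne', one_smul]
      conv_rhs => rw [e2]
      rw [show t / (1 + t) = 1 / (1 + t) * t by ring]
      module
    rw [e1, hpt, ha] at h5
    have h6 := h (w - t • (w' - w))
    rw [show w - t • (w' - w) - w = -(t • (w' - w)) by module, inner_neg_right, inner_smul_right,
      norm_neg, norm_smul, Real.norm_of_nonneg ht0.le, ← sub_eq_add_neg] at h6
    refine h5.trans ?_
    rw [EReal.coe_mul]
    gcongr
  induction hb : f w' with
  | top => exact le_top
  | bot =>
    obtain ⟨t, ht, ht0⟩ := (h4.and h3).exists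
    have h5 : 0 < t / (1 + t) := by positivity
    simp [hb, EReal.coe_mul_bot_of_pos h5] at ht
  | coe b =>
    have h5 : Tendsto (fun t : ℝ => b + t * (c * ‖w' - w‖ ^ 2)) (𝓝[>] 0) (𝓝 b) := by
      have : Continuous fun t : ℝ => b + t * (c * ‖w' - w‖ ^ 2) := by fun_prop
      have := this.tendsto 0
      simp only [zero_mul, add_zero] at this
      exact this.mono_left nhdsWithin_le_nhds
    refine EReal.coe_le_coe_iff.2 (ge_of_tendsto h5 ?_)
    filter_upwards [h4, h3] with t ht ht0
    have hs : 0 < 1 + t := by linarith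
    rw [hb] at ht
    norm_cast at ht
    rw [div_mul_eq_mul_div, div_mul_eq_mul_div, ← add_div, le_div_iff₀ hs] at ht
    have h8 : t * (a + inner ℝ v (w' - w) - b - t * (c * ‖w' - w‖ ^ 2)) ≤ 0 := by nlinarith
    have h9 := nonpos_of_mul_nonpos_right h8 ht0
    linarith

/-! ### Prox-boundedness and subgradient inequalities. -/

theorem IsProxBounded.exists_quadratic_minorant {n : ℕ} {φ : RSpace n → EReal}
    (h : IsProxBounded φ) :
    ∃ (K c : ℝ) (x₁ : RSpace n), 0 ≤ K ∧ ∀ y, ((c - K * ‖y - x₁‖ ^ 2 : ℝ) : EReal) ≤ φ y := by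
  obtain ⟨l, hl, x₁, h⟩ := h
  obtain ⟨c, -, hc⟩ := EReal.lt_iff_exists_real_btwn.1 h
  refine ⟨1 / (2 * l), c, x₁, by positivity, fun y => ?_⟩
  have := hc.le.trans (iInf_le _ y)
  induction hy : φ y with
  | bot => simp [hy] at this
  | top => exact le_top
  | coe b =>
    rw [hy] at this
    norm_cast at this ⊢
    linarith

/-- The prox-regularity inequality with modulus `0`: limiting subgradients of `φ` near
`(xbar, vbar)` at points with function value near `φ xbar` are subgradients in the sense of convex
analysis relative to a neighborhood of `xbar`. -/
def HasLocalSubgradientInequality {n : ℕ} (φ : RSpace n → EReal) (xbar vbar : RSpace n) : Prop :=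
  ∃ ε : ℝ, 0 < ε ∧
    ∀ x ∈ Metric.closedBall xbar ε, ∀ u ∈ Metric.closedBall xbar ε,
      ∀ v ∈ Metric.closedBall vbar ε,
        v ∈ limitingSubdifferential φ u → φ u < φ xbar + (ε : EReal) →
          φ u + ((inner ℝ v (x - u) : ℝ) : EReal) ≤ φ x

theorem HasLocalSubgradientInequality.isProxRegularAt {n : ℕ} {φ : RSpace n → EReal}
    {xbar vbar : RSpace n} (h : HasLocalSubgradientInequality φ xbar vbar) :
    IsProxRegularAt φ xbar vbar := by
  obtain ⟨ε, hε, h⟩ := h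
  exact ⟨ε, 0, hε, le_rfl, by simpa using h⟩

theorem IsVariationallyConvexAt.hasLocalSubgradientInequality {n : ℕ} {φ : RSpace n → EReal}
    {xbar vbar : RSpace n} (h : IsVariationallyConvexAt φ xbar vbar) :
    HasLocalSubgradientInequality φ xbar vbar := by
  obtain ⟨U, V, hU, -, hxU, hV, -, hvV, ψ, ε, hε, hbot, -, hconv, hle, hgph, heq⟩ := h
  obtain ⟨ε₁, hε₁, h₁⟩ := Metric.nhds_basis_closedBall.mem_iff.1 (hU.mem_nhds hxU)
  obtain ⟨ε₂, hε₂, h₂⟩ := Metric.nhds_basis_closedBall.mem_iff.1 (hV.mem_nhds hvV)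
  refine ⟨min ε (min ε₁ ε₂), by positivity, fun x hx u hu v hv hsub hlt => ?_⟩
  have hxU' := h₁ (Metric.closedBall_subset_closedBall
    ((min_le_right _ _).trans (min_le_left _ _)) hx)
  have huU := h₁ (Metric.closedBall_subset_closedBall
    ((min_le_right _ _).trans (min_le_left _ _)) hu)
  have hvV' := h₂ (Metric.closedBall_subset_closedBall
    ((min_le_right _ _).trans (min_le_right _ _)) hv)
  have hlt' : φ u < φ xbar + (ε : EReal) :=
    hlt.trans_le (add_le_add_right (EReal.coe_le_coe_iff.2 (min_le_left _ _)) _)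
  have hψ := (hgph u huU v hvV').1 ⟨hlt', hsub⟩
  rw [heq u huU v hvV' hψ]
  exact (hconv.le_of_mem_limitingSubdifferential hU huU hψ hxU' (hbot x hxU')).trans (hle x hxU')

/-- Far from `xbar` the quadratic minorant of `φ` takes over from prox-regularity. As `y` then stays
away from `u`, a large `s` absorbs all lower-order terms, uniformly in `u` and `v`. -/
theorem IsProxRegularAt.exists_global_inequality {n : ℕ} {φ : RSpace n → EReal}
    {xbar vbar : RSpace n} {p : ℝ} (h : IsProxRegularAt φ xbar vbar) (hpb : IsProxBounded φ)
    (hp : φ xbar = p) :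
    ∃ s δ : ℝ, 0 < s ∧ 0 < δ ∧ ∀ u v : RSpace n, ∀ a : ℝ, ‖u - xbar‖ ≤ δ → ‖v - vbar‖ ≤ δ →
      v ∈ limitingSubdifferential φ u → φ u = a → a < p + δ →
        ∀ y, ((a + inner ℝ v (y - u) - s / 2 * ‖y - u‖ ^ 2 : ℝ) : EReal) ≤ φ y := by
  obtain ⟨ε, r, hε, hr, h⟩ := h
  obtain ⟨K, c, x₁, hK, hφ⟩ := hpb.exists_quadratic_minorant
  obtain ⟨ρ, hρ, rfl⟩ : ∃ ρ, 0 < ρ ∧ ε = 2 * ρ := ⟨ε / 2, by positivity, by ring⟩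
  set A := |p + ρ - c| with hA
  set M := ‖vbar‖ + ρ with hM
  set R := ‖xbar - x₁‖ + ρ with hR
  have hA0 : 0 ≤ A := abs_nonneg _
  have hM0 : 0 ≤ M := by positivity
  have hR0 : 0 ≤ R := by positivity
  -- For `y` outside the ball of radius `2 * ρ` and `u` in that of radius `ρ`, `d = ‖y - u‖ ≥ ρ`.
  -- Multiplying by powers of `d / ρ ≥ 1` turns the constant, linear and quadratic contributions
  -- into the three multiples of `d ^ 2` summed here.
  set C := A / ρ ^ 2 + M / ρ + K * (1 + R / ρ) ^ 2 with hC
  have hC0 : 0 ≤ C := by positivity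
  refine ⟨r + 2 * C + 1, ρ, by positivity, hρ, fun u v a hu hv hsub ha hlt y => ?_⟩
  by_cases hy : y ∈ Metric.closedBall xbar (2 * ρ)
  · have h1 := h y hy u (mem_closedBall_iff_norm.2 (by linarith)) v
      (mem_closedBall_iff_norm.2 (by linarith)) hsub (by rw [ha, hp]; norm_cast; linarith)
    refine le_trans ?_ h1
    rw [ha]
    norm_cast
    nlinarith [sq_nonneg ‖y - u‖]
  · rw [mem_closedBall_iff_norm, not_le] at hy
    refine le_trans (EReal.coe_le_coe_iff.2 ?_) (hφ y)
    set d := ‖y - u‖ with hd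
    have hdρ : ρ ≤ d := by
      have := norm_add_le (y - u) (u - xbar)
      rw [sub_add_sub_cancel] at this
      linarith
    have hd0 : 0 < d := hρ.trans_le hdρ
    have h1 : ‖y - x₁‖ ≤ d + R := by
      have h2 := norm_add_le (y - u) (u - xbar)
      have h3 := norm_add_le (y - xbar) (xbar - x₁)
      rw [sub_add_sub_cancel] at h2 h3
      linarith
    have h2 : inner ℝ v (y - u) ≤ M * d := by
      refine (real_inner_le_norm _ _).trans ?_
      gcongr
      have := norm_add_le (v - vbar) vbar
      rw [sub_add_cancel] at this
      linarith
    have h3 : 1 ≤ d / ρ := (one_le_div hρ).2 hdρ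
    have h4 : a - c ≤ A / ρ ^ 2 * d ^ 2 := by
      calc a - c ≤ A := by rw [hA]; exact (by linarith : a - c ≤ p + ρ - c).trans (le_abs_self _)
        _ ≤ A * (d / ρ) ^ 2 := le_mul_of_one_le_right hA0 (one_le_pow₀ h3)
        _ = A / ρ ^ 2 * d ^ 2 := by ring
    have h5 : M * d ≤ M / ρ * d ^ 2 := by
      calc M * d ≤ M * d * (d / ρ) := le_mul_of_one_le_right (by positivity) h3
        _ = M / ρ * d ^ 2 := by ring
    have h6 : K * ‖y - x₁‖ ^ 2 ≤ K * (1 + R / ρ) ^ 2 * d ^ 2 := by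
      have : ‖y - x₁‖ ≤ (1 + R / ρ) * d := by
        have : R ≤ R * (d / ρ) := le_mul_of_one_le_right hR0 h3
        calc ‖y - x₁‖ ≤ d + R * (d / ρ) := by linarith
          _ = (1 + R / ρ) * d := by ring
      calc K * ‖y - x₁‖ ^ 2 ≤ K * ((1 + R / ρ) * d) ^ 2 := by gcongr
        _ = _ := by ring
    have h7 : C * d ^ 2 = A / ρ ^ 2 * d ^ 2 + M / ρ * d ^ 2 + K * (1 + R / ρ) ^ 2 * d ^ 2 := by
      rw [hC]; ring
    nlinarith [sq_nonneg d]

/-! ### Moreau envelopes and proximal points. -/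

/-- Completing the square, the hypothesis says exactly that `u` attains the infimum defining the
envelope at `u + lam • v`. -/
theorem moreauEnvelope_add_smul_eq {n : ℕ} {φ : RSpace n → EReal} {u v : RSpace n} {a lam : ℝ}
    (hlam : 0 < lam) (ha : φ u = a)
    (h : ∀ y, ((a + inner ℝ v (y - u) - 1 / (2 * lam) * ‖y - u‖ ^ 2 : ℝ) : EReal) ≤ φ y) :
    moreauEnvelope lam φ (u + lam • v) = ((a + lam / 2 * ‖v‖ ^ 2 : ℝ) : EReal) := by
  refine le_antisymm ((iInf_le _ u).trans ?_) (le_iInf fun y => ?_)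
  · rw [ha, show u - (u + lam • v) = -(lam • v) by module, norm_neg, norm_smul,
      Real.norm_of_nonneg hlam.le]
    norm_cast
    apply le_of_eq
    field_simp
  · refine le_trans ?_ (add_le_add_left (h y) _)
    norm_cast
    rw [show y - (u + lam • v) = (y - u) - lam • v by module, norm_sub_sq_real (y - u),
      norm_smul, Real.norm_of_nonneg hlam.le, inner_smul_right, real_inner_comm v]
    apply le_of_eq
    field_simp
    ring

theorem moreauEnvelope_le_quadratic {n : ℕ} {φ : RSpace n → EReal} {u v : RSpace n} {a lam : ℝ}
    (hlam : 0 < lam) (ha : φ u = a) (y : RSpace n) :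
    moreauEnvelope lam φ y ≤ ((a + lam / 2 * ‖v‖ ^ 2 + inner ℝ v (y - (u + lam • v)) +
      1 / (2 * lam) * ‖y - (u + lam • v)‖ ^ 2 : ℝ) : EReal) := by
  refine (iInf_le _ u).trans ?_
  rw [ha]
  norm_cast
  rw [show u - y = -((y - (u + lam • v)) + lam • v) by module, norm_neg, norm_add_sq_real,
    norm_smul, Real.norm_of_nonneg hlam.le, inner_smul_right, real_inner_comm v]
  apply le_of_eq
  field_simp
  ring

/-- Since `lam * s < 1`, the proximal objective centred at `xbar + lam • vbar` grows quadratically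
away from its minimizer `xbar`. Moving the centre by `k` adds only a term linear in `y` (and a
constant), so minimizers persist within distance of order `‖k‖`. -/
theorem exists_prox_point {n : ℕ} {φ : RSpace n → EReal} (hlsc : LowerSemicontinuous φ)
    {xbar vbar : RSpace n} {p s lam : ℝ} (hp : φ xbar = p) (hlam : 0 < lam) (hs : lam * s < 1)
    (h : ∀ y, ((p + inner ℝ vbar (y - xbar) - s / 2 * ‖y - xbar‖ ^ 2 : ℝ) : EReal) ≤ φ y)
    {η : ℝ} (hη : 0 < η) :
    ∃ δ : ℝ, 0 < δ ∧ ∀ w, ‖w - (xbar + lam • vbar)‖ < δ →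
      ∃ (q v : RSpace n) (b : ℝ), w = q + lam • v ∧ φ q = b ∧ ‖q - xbar‖ < η ∧ ‖v - vbar‖ < η ∧
        b < p + η ∧
        ∀ y, ((b + inner ℝ v (y - q) - 1 / (2 * lam) * ‖y - q‖ ^ 2 : ℝ) : EReal) ≤ φ y := by
  -- Here `m` is the quadratic growth rate; it beats the perturbation `‖k‖ * ‖y - xbar‖ / lam` once
  -- `‖y - xbar‖ ≥ ‖k‖ * L`. Hence a minimizer over the compact ball of that radius is global.
  obtain ⟨m, hm, hsm⟩ : ∃ m, 0 < m ∧ s = 1 / lam - 2 * m :=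
    ⟨(1 / lam - s) / 2, by have : s < 1 / lam := by rw [lt_div_iff₀ hlam]; linarith
                           linarith, by ring⟩
  set L := 1 / (lam * m) with hL
  have hL0 : 0 < L := by positivity
  -- The summands bound `‖q - xbar‖`, `‖v - vbar‖` and `b - p` per unit of `‖k‖`; the last one uses
  -- `‖k‖ < 1`.
  set C := L + (1 + L) / lam + L * (lam * ‖vbar‖ + 1) / lam with hC
  have hC1 : 0 < L * (lam * ‖vbar‖ + 1) / lam := by positivity
  have hC2 : 0 < (1 + L) / lam := by positivity
  have hC0 : 0 < C := by positivity
  refine ⟨min 1 (η / C), by positivity, fun w hw => ?_⟩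
  obtain ⟨k, rfl⟩ : ∃ k, w = xbar + lam • vbar + k := ⟨w - (xbar + lam • vbar), by module⟩
  rw [add_sub_cancel_left, lt_min_iff, lt_div_iff₀ hC0] at hw
  obtain ⟨hk1, hkC⟩ := hw
  set w := xbar + lam • vbar + k with hwdef
  set g : RSpace n → EReal := fun y => φ y + ((1 / (2 * lam) * ‖y - w‖ ^ 2 : ℝ) : EReal) with hg
  have hglsc : LowerSemicontinuous g := by
    refine hlsc.add' ?_ fun x => EReal.continuousAt_add (Or.inr (EReal.coe_ne_bot _))
      (Or.inr (EReal.coe_ne_top _))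
    refine Continuous.lowerSemicontinuous ?_
    exact continuous_coe_real_ereal.comp (by fun_prop)
  obtain ⟨q, hq, hmin⟩ := (hglsc.lowerSemicontinuousOn
      (Metric.closedBall xbar (‖k‖ * L))).exists_isMinOn
    (Metric.nonempty_closedBall.2 (by positivity)) (isCompact_closedBall _ _)
  have hxb := hmin (Metric.mem_closedBall_self (x := xbar) (ε := ‖k‖ * L) (by positivity))
  have hmin' : ∀ y, g q ≤ g y := by
    intro y
    by_cases hy : y ∈ Metric.closedBall xbar (‖k‖ * L)
    · exact hmin hy
    · refine le_trans hxb ?_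
      rw [mem_closedBall_iff_norm, not_le] at hy
      refine le_trans ?_ (add_le_add_left (h y) _)
      simp only [hg]
      rw [hp]
      norm_cast
      rw [show xbar - w = -(lam • vbar + k) by rw [hwdef]; module,
        show y - w = (y - xbar) - (lam • vbar + k) by rw [hwdef]; module, norm_neg,
        norm_sub_sq_real (y - xbar), inner_add_right, inner_smul_right, real_inner_comm vbar, hsm]
      have h1 : inner ℝ (y - xbar) k ≤ lam * m * ‖y - xbar‖ ^ 2 := by
        refine (real_inner_le_norm _ _).trans ?_
        have : ‖k‖ ≤ lam * m * ‖y - xbar‖ := by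
          rw [hL, mul_one_div, div_lt_iff₀ (by positivity)] at hy
          linarith
        nlinarith [norm_nonneg (y - xbar)]
      have h2 : 1 / lam * inner ℝ (y - xbar) k ≤ m * ‖y - xbar‖ ^ 2 := by
        rw [one_div_mul_eq_div, div_le_iff₀ hlam]
        linarith
      have e : 1 / (2 * lam) * (‖y - xbar‖ ^ 2 -
          2 * (lam * inner ℝ vbar (y - xbar) + inner ℝ (y - xbar) k) + ‖lam • vbar + k‖ ^ 2) =
          1 / lam / 2 * ‖y - xbar‖ ^ 2 - inner ℝ vbar (y - xbar) - 1 / lam * inner ℝ (y - xbar) k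
            + 1 / (2 * lam) * ‖lam • vbar + k‖ ^ 2 := by
        field_simp
        ring
      rw [e]
      linarith
  obtain ⟨b, hb⟩ : ∃ b : ℝ, φ q = b := by
    induction hφ : φ q with
    | bot => exact absurd (hφ ▸ h q) (not_le.2 (EReal.bot_lt_coe _))
    | top =>
      have h1 := hmin' xbar
      simp only [hg] at h1
      rw [hφ, hp, EReal.top_add_coe] at h1
      norm_cast at h1
    | coe b => exact ⟨b, rfl⟩
  have hqx : ‖q - xbar‖ ≤ ‖k‖ * L := mem_closedBall_iff_norm.1 hq
  have hv : lam⁻¹ • (w - q) - vbar = lam⁻¹ • (k - (q - xbar)) := by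
    have : vbar = lam⁻¹ • lam • vbar := by rw [smul_smul, inv_mul_cancel₀ hlam.ne', one_smul]
    conv_lhs => rw [this]
    rw [hwdef]
    module
  have hwq : w = q + lam • lam⁻¹ • (w - q) := by
    rw [smul_smul, mul_inv_cancel₀ hlam.ne', one_smul]; module
  have hkC' : ‖k‖ * L + ‖k‖ * ((1 + L) / lam) + ‖k‖ * (L * (lam * ‖vbar‖ + 1) / lam) < η := by
    rw [← mul_add, ← mul_add]; exact hkC
  have hn0 := norm_nonneg k
  refine ⟨q, lam⁻¹ • (w - q), b, hwq, hb, ?_, ?_, ?_, fun y => ?_⟩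
  · have := mul_nonneg hn0 hC1.le
    have := mul_nonneg hn0 hC2.le
    linarith
  · rw [hv, norm_smul, norm_inv, Real.norm_of_nonneg hlam.le]
    have h1 : lam⁻¹ * ‖k - (q - xbar)‖ ≤ ‖k‖ * ((1 + L) / lam) := by
      calc lam⁻¹ * ‖k - (q - xbar)‖ ≤ lam⁻¹ * (‖k‖ + ‖k‖ * L) := by
            gcongr
            exact (norm_sub_le _ _).trans (by linarith)
        _ = _ := by field_simp
    have := mul_nonneg hn0 hC1.le
    have := mul_nonneg hn0 hL0.le
    linarith
  · have h1 := hmin' xbar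
    simp only [hg] at h1
    rw [hb, hp, show xbar - w = -(lam • vbar + k) by rw [hwdef]; module,
      show q - w = (q - xbar) - (lam • vbar + k) by rw [hwdef]; module, norm_neg,
      norm_sub_sq_real (q - xbar)] at h1
    norm_cast at h1
    have h2 : inner ℝ (q - xbar) (lam • vbar + k) ≤ ‖k‖ * L * (lam * ‖vbar‖ + 1) := by
      refine (real_inner_le_norm _ _).trans ?_
      gcongr
      refine (norm_add_le _ _).trans ?_
      rw [norm_smul, Real.norm_of_nonneg hlam.le]
      linarith
    have h3 : 1 / lam * inner ℝ (q - xbar) (lam • vbar + k) ≤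
        ‖k‖ * (L * (lam * ‖vbar‖ + 1) / lam) := by
      calc _ ≤ 1 / lam * (‖k‖ * L * (lam * ‖vbar‖ + 1)) := by gcongr
        _ = _ := by ring
    have e : 1 / (2 * lam) * (‖q - xbar‖ ^ 2 - 2 * inner ℝ (q - xbar) (lam • vbar + k) +
        ‖lam • vbar + k‖ ^ 2) = 1 / (2 * lam) * ‖q - xbar‖ ^ 2 -
          1 / lam * inner ℝ (q - xbar) (lam • vbar + k) +
            1 / (2 * lam) * ‖lam • vbar + k‖ ^ 2 := by
      field_simp
    rw [e] at h1
    have h4 : 0 ≤ 1 / (2 * lam) * ‖q - xbar‖ ^ 2 := by positivity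
    have := mul_nonneg hn0 hC2.le
    have := mul_nonneg hn0 hL0.le
    linarith
  · have h1 := hmin' y
    simp only [hg] at h1
    rw [hb] at h1
    induction hφ : φ y with
    | top => exact le_top
    | bot => exact absurd (hφ ▸ h y) (not_le.2 (EReal.bot_lt_coe _))
    | coe d =>
      rw [hφ] at h1
      norm_cast at h1 ⊢
      rw [show y - w = (y - q) - (w - q) by module, norm_sub_sq_real (y - q),
        norm_sub_rev q w] at h1
      rw [real_inner_smul_left, real_inner_comm]
      have e : 1 / (2 * lam) * (‖y - q‖ ^ 2 - 2 * inner ℝ (y - q) (w - q) + ‖w - q‖ ^ 2) =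
          1 / (2 * lam) * ‖y - q‖ ^ 2 - lam⁻¹ * inner ℝ (y - q) (w - q) +
            1 / (2 * lam) * ‖w - q‖ ^ 2 := by
        field_simp
      rw [e] at h1
      linarith

/-! ### Local convexity of envelopes versus the subgradient inequality. -/

theorem isConvexFunOn_of_subgradients {n : ℕ} {f : RSpace n → EReal} {W : Set (RSpace n)}
    (hW : Convex ℝ W)
    (h : ∀ w ∈ W, ∃ (v : RSpace n) (a : ℝ), f w = a ∧
      ∀ w' ∈ W, ((a + inner ℝ v (w' - w) : ℝ) : EReal) ≤ f w') :
    IsConvexFunOn f W := by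
  refine ⟨hW, fun x hx y hy t ht0 ht1 => ?_⟩
  obtain ⟨v, a, ha, hv⟩ := h _ (hW hx hy (sub_nonneg.2 ht1) ht0 (by ring))
  obtain ⟨-, b, hb, -⟩ := h x hx
  obtain ⟨-, c, hc, -⟩ := h y hy
  have h1 := hv x hx
  have h2 := hv y hy
  rw [hb, show x - ((1 - t) • x + t • y) = t • (x - y) by module, inner_smul_right] at h1
  rw [hc, show y - ((1 - t) • x + t • y) = (-(1 - t)) • (x - y) by module, inner_smul_right] at h2
  rw [ha, hb, hc]
  norm_cast at h1 h2 ⊢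
  nlinarith

theorem HasLocalSubgradientInequality.eventually_isLocallyConvexAround {n : ℕ}
    {φ : RSpace n → EReal} {xbar vbar : RSpace n}
    (h : HasLocalSubgradientInequality φ xbar vbar) (hlsc : LowerSemicontinuous φ)
    (hpb : IsProxBounded φ) (hv : vbar ∈ limitingSubdifferential φ xbar) :
    ∀ᶠ lam : ℝ in 𝓝[>] 0, IsLocallyConvexAround (moreauEnvelope lam φ) (xbar + lam • vbar) := by
  have hp := (EReal.coe_toReal hv.1 hv.2.1).symm
  set p := (φ xbar).toReal
  obtain ⟨s, δ, hs, hδ, hglob⟩ := h.isProxRegularAt.exists_global_inequality hpb hp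
  have hglob' := hglob xbar vbar p (by simpa using hδ.le) (by simpa using hδ.le) hv hp (by linarith)
  obtain ⟨ε, hε, h⟩ := h
  filter_upwards [Ioo_mem_nhdsGT (inv_pos.2 hs)] with lam hlam
  have hlam0 : 0 < lam := hlam.1
  have hlams : lam * s < 1 := by
    have := mul_lt_mul_of_pos_right hlam.2 hs
    rwa [inv_mul_cancel₀ hs.ne'] at this
  obtain ⟨ρ, hρ, hprox⟩ := exists_prox_point hlsc hp hlam0 hlams hglob' hε
  refine ⟨Metric.ball _ ρ, Metric.ball_mem_nhds _ hρ,
    isConvexFunOn_of_subgradients (convex_ball _ _) fun w hw => ?_⟩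
  obtain ⟨q, v, b, rfl, hb, hq, hvv, hbp, hquad⟩ := hprox w (mem_ball_iff_norm.1 hw)
  refine ⟨v, _, moreauEnvelope_add_smul_eq hlam0 hb hquad, fun w' hw' => ?_⟩
  obtain ⟨q', v', b', rfl, hb', hq', hvv', hbp', hquad'⟩ := hprox w' (mem_ball_iff_norm.1 hw')
  rw [moreauEnvelope_add_smul_eq hlam0 hb' hquad']
  have h1 := h q' (mem_closedBall_iff_norm.2 hq'.le) q (mem_closedBall_iff_norm.2 hq.le) v
    (mem_closedBall_iff_norm.2 hvv.le)
    (regularSubdifferential_subset_limitingSubdifferential _ _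
      (mem_regularSubdifferential_of_quadratic hb hquad)) (by rw [hb, hp]; exact_mod_cast hbp)
  rw [hb, hb'] at h1
  norm_cast at h1 ⊢
  rw [show q' + lam • v' - (q + lam • v) = (q' - q) + lam • (v' - v) by module, inner_add_right,
    inner_smul_right, inner_sub_right v v', real_inner_self_eq_norm_sq]
  -- Given the support inequality between `q` and `q'`, the remaining slack is `lam / 2 * ‖v' - v‖ ^
  -- 2`.
  have h2 := sq_nonneg ‖v' - v‖
  rw [norm_sub_sq_real, real_inner_comm] at h2
  nlinarith

/-- A single `lam < 1 / s` with a locally convex envelope suffices. The envelope at `u + lam • v` is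
touched from above by a quadratic with gradient `v`, so convexity makes `v` a subgradient there;
testing at `x + lam • v` keeps the displacement equal to `x - u`. -/
theorem IsProxRegularAt.hasLocalSubgradientInequality {n : ℕ}
    {φ : RSpace n → EReal} {xbar vbar : RSpace n}
    (h : IsProxRegularAt φ xbar vbar) (hpb : IsProxBounded φ) {p : ℝ} (hp : φ xbar = p)
    (hconv : ∀ᶠ lam : ℝ in 𝓝[>] 0,
      IsLocallyConvexAround (moreauEnvelope lam φ) (xbar + lam • vbar)) :
    HasLocalSubgradientInequality φ xbar vbar := by
  obtain ⟨s, δ, hs, hδ, hglob⟩ := h.exists_global_inequality hpb hp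
  obtain ⟨lam, ⟨W, hW, hWconv⟩, hlam0, hlams⟩ :=
    (hconv.and (Ioo_mem_nhdsGT (inv_pos.2 hs))).exists
  obtain ⟨ρ, hρ, hball⟩ := Metric.mem_nhds_iff.1 hW
  have hmem : ∀ x v : RSpace n, ‖x - xbar‖ ≤ ρ / (2 * (1 + lam)) →
      ‖v - vbar‖ ≤ ρ / (2 * (1 + lam)) → x + lam • v ∈ Metric.ball (xbar + lam • vbar) ρ := by
    intro x v hx hv
    rw [mem_ball_iff_norm, show x + lam • v - (xbar + lam • vbar) =
      (x - xbar) + lam • (v - vbar) by module]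
    refine (norm_add_le _ _).trans_lt ?_
    rw [norm_smul, Real.norm_of_nonneg hlam0.le]
    calc _ ≤ ρ / (2 * (1 + lam)) + lam * (ρ / (2 * (1 + lam))) := by gcongr
      _ = ρ / 2 := by field_simp
      _ < ρ := by linarith
  refine ⟨min δ (ρ / (2 * (1 + lam))), by positivity, fun x hx u hu v hv hsub hlt => ?_⟩
  rw [mem_closedBall_iff_norm, le_min_iff] at hx hu hv
  have ha := (EReal.coe_toReal hsub.1 hsub.2.1).symm
  set a := (φ u).toReal
  have hap : a < p + δ := by
    rw [ha, hp] at hlt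
    have : a < p + min δ (ρ / (2 * (1 + lam))) := by exact_mod_cast hlt
    linarith [min_le_left δ (ρ / (2 * (1 + lam)))]
  have hls : s ≤ 1 / lam := by
    rw [one_div]
    exact (le_inv_comm₀ hlam0 hs).1 hlams.le
  have hquad : ∀ y, ((a + inner ℝ v (y - u) - 1 / (2 * lam) * ‖y - u‖ ^ 2 : ℝ) : EReal) ≤ φ y := by
    refine fun y => le_trans (EReal.coe_le_coe_iff.2 ?_) (hglob u v a hu.1 hv.1 hsub ha hap y)
    rw [show 1 / (2 * lam) = 1 / lam / 2 by ring]
    gcongr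
  have h1 := hWconv.le_of_quadratic_majorant
    (mem_of_superset (Metric.isOpen_ball.mem_nhds (hmem u v hu.2 hv.2)) hball)
    (hball (hmem x v hx.2 hv.2)) (moreauEnvelope_add_smul_eq hlam0 ha hquad)
    (moreauEnvelope_le_quadratic hlam0 ha)
  rw [add_sub_add_right_eq_sub] at h1
  induction hφ : φ x with
  | top => exact le_top
  | bot => exact absurd (hφ ▸ hquad x) (not_le.2 (EReal.bot_lt_coe _))
  | coe b =>
    -- With `x` as competitor at `x + lam • v`, the penalty is `lam / 2 * ‖v‖ ^ 2`, which cancels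
    -- the same term in the envelope value at `u + lam • v`.
    have h2 := h1.trans (iInf_le _ x)
    rw [hφ, show x - (x + lam • v) = -(lam • v) by module, norm_neg, norm_smul,
      Real.norm_of_nonneg hlam0.le] at h2
    rw [ha]
    norm_cast at h2 ⊢
    have e : 1 / (2 * lam) * (lam * ‖v‖) ^ 2 = lam / 2 * ‖v‖ ^ 2 := by field_simp
    rw [e] at h2
    linarith

/-! ### The convex minorant generated by affine supports. -/

/-- The supremum of the affine functions `y ↦ a + ⟪v, y - u⟫` over `(u, v, a) ∈ S`. -/
noncomputable def affineSup {n : ℕ} (S : Set (RSpace n × RSpace n × ℝ)) (y : RSpace n) : EReal :=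
  ⨆ t ∈ S, ((t.2.2 + inner ℝ t.2.1 (y - t.1) : ℝ) : EReal)

theorem le_affineSup {n : ℕ} {S : Set (RSpace n × RSpace n × ℝ)} {u v : RSpace n} {a : ℝ}
    (h : (u, v, a) ∈ S) (y : RSpace n) :
    ((a + inner ℝ v (y - u) : ℝ) : EReal) ≤ affineSup S y :=
  le_iSup₂ (f := fun (t : RSpace n × RSpace n × ℝ) (_ : t ∈ S) =>
    ((t.2.2 + inner ℝ t.2.1 (y - t.1) : ℝ) : EReal)) _ h

theorem lowerSemicontinuous_affineSup {n : ℕ} (S : Set (RSpace n × RSpace n × ℝ)) :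
    LowerSemicontinuous (affineSup S) :=
  lowerSemicontinuous_biSup fun _ _ =>
    (continuous_coe_real_ereal.comp (by fun_prop)).lowerSemicontinuous

theorem isConvexFunOn_affineSup {n : ℕ} (S : Set (RSpace n × RSpace n × ℝ))
    {U : Set (RSpace n)} (hU : Convex ℝ U) : IsConvexFunOn (affineSup S) U := by
  refine ⟨hU, fun x _ y _ t ht0 ht1 => iSup₂_le fun ⟨u, v, a⟩ h => ?_⟩
  refine le_trans ?_ (add_le_add
    (mul_le_mul_of_nonneg_left (le_affineSup h x) (EReal.coe_nonneg.2 (sub_nonneg.2 ht1)))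
    (mul_le_mul_of_nonneg_left (le_affineSup h y) (EReal.coe_nonneg.2 ht0)))
  norm_cast
  rw [show (1 - t) • x + t • y - u = (1 - t) • (x - u) + t • (y - u) by module, inner_add_right,
    inner_smul_right, inner_smul_right]
  apply le_of_eq
  ring

theorem HasLocalSubgradientInequality.isVariationallyConvexAt {n : ℕ}
    {φ : RSpace n → EReal} {xbar vbar : RSpace n}
    (h : HasLocalSubgradientInequality φ xbar vbar) (hlsc : LowerSemicontinuous φ)
    (hpb : IsProxBounded φ) (hv : vbar ∈ limitingSubdifferential φ xbar) :
    IsVariationallyConvexAt φ xbar vbar := by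
  have hp := (EReal.coe_toReal hv.1 hv.2.1).symm
  set p := (φ xbar).toReal
  obtain ⟨s, δ, hs, hδ, hglob⟩ := h.isProxRegularAt.exists_global_inequality hpb hp
  have hglob' := hglob xbar vbar p (by simpa using hδ.le) (by simpa using hδ.le) hv hp (by linarith)
  obtain ⟨ε, hε, h⟩ := h
  obtain ⟨lam, hlam0, hlams⟩ : ∃ lam : ℝ, 0 < lam ∧ lam * s < 1 :=
    ⟨1 / (s + 1), by positivity, by rw [one_div_mul_eq_div, div_lt_one (by positivity)]; linarith⟩
  obtain ⟨ρ, hρ, hprox⟩ := exists_prox_point hlsc hp hlam0 hlams hglob' hε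
  set S : Set (RSpace n × RSpace n × ℝ) := {t | ‖t.1 - xbar‖ ≤ ε ∧ ‖t.2.1 - vbar‖ ≤ ε ∧
    t.2.1 ∈ limitingSubdifferential φ t.1 ∧ φ t.1 = (t.2.2 : ℝ) ∧ t.2.2 < p + ε} with hS
  have hSbar : (xbar, vbar, p) ∈ S :=
    ⟨by simpa using hε.le, by simpa using hε.le, hv, hp, by simpa using hε⟩
  have hψφ : ∀ x ∈ Metric.closedBall xbar ε, affineSup S x ≤ φ x := by
    refine fun x hx => iSup₂_le fun ⟨u, v, a⟩ ⟨h1, h2, h3, h4, h5⟩ => ?_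
    have h6 := h x hx u (mem_closedBall_iff_norm.2 h1) v (mem_closedBall_iff_norm.2 h2) h3
      (by rw [h4, hp]; exact_mod_cast h5)
    rw [h4] at h6
    exact_mod_cast h6
  have hψS : ∀ u v a, (u, v, a) ∈ S → affineSup S u = (a : ℝ) := by
    refine fun u v a hm => le_antisymm ?_ (by simpa using le_affineSup hm u)
    rw [← hm.2.2.2.1]
    exact hψφ u (mem_closedBall_iff_norm.2 hm.1)
  have hψsub : ∀ u v a, (u, v, a) ∈ S → v ∈ limitingSubdifferential (affineSup S) u :=
    fun u v a hm => regularSubdifferential_subset_limitingSubdifferential _ _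
      (mem_regularSubdifferential_of_quadratic (c := 0) (hψS u v a hm)
        (by simpa using le_affineSup hm))
  have hψbot : ∀ x, affineSup S x ≠ ⊥ := fun x =>
    ((EReal.bot_lt_coe _).trans_le (le_affineSup hSbar x)).ne'
  -- This keeps `x + lam • v` within `ρ` of `xbar + lam • vbar`, where proximal points are
  -- available.
  set κ := min ε (ρ / (1 + lam)) with hκ
  have hκ0 : 0 < κ := by positivity
  -- Minty-type argument: write `x + lam • v = q + lam • v'` with `(q, v', b) ∈ S`. Adding the
  -- subgradient inequalities of `affineSup S` at `x` and at `q` gives `lam * ‖v - v'‖ ^ 2 ≤ 0`,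
  -- hence `v = v'` and `x = q`.
  have hrev : ∀ x ∈ Metric.ball xbar κ, ∀ v ∈ Metric.ball vbar κ,
      v ∈ limitingSubdifferential (affineSup S) x → ∃ a, (x, v, a) ∈ S := by
    intro x hx v hv hsub
    rw [mem_ball_iff_norm] at hx hv
    have hw : ‖x + lam • v - (xbar + lam • vbar)‖ < ρ := by
      rw [show x + lam • v - (xbar + lam • vbar) = (x - xbar) + lam • (v - vbar) by module]
      refine (norm_add_le _ _).trans_lt ?_
      rw [norm_smul, Real.norm_of_nonneg hlam0.le]
      have h1 : κ * (1 + lam) ≤ ρ := (le_div_iff₀ (by positivity)).1 (min_le_right _ _)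
      nlinarith
    obtain ⟨q, v', b, hqv, hb, hq, hv', hbp, hquad⟩ := hprox _ hw
    have hmem : (q, v', b) ∈ S := ⟨hq.le, hv'.le,
      regularSubdifferential_subset_limitingSubdifferential _ _
        (mem_regularSubdifferential_of_quadratic hb hquad), hb, hbp⟩
    have h1 := (isConvexFunOn_affineSup S convex_univ).le_of_mem_limitingSubdifferential
      isOpen_univ (Set.mem_univ x) hsub (Set.mem_univ q) (hψbot q)
    have h2 := le_affineSup hmem x
    rw [hψS q v' b hmem] at h1
    rw [← EReal.coe_toReal hsub.1 hsub.2.1] at h1 h2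
    norm_cast at h1 h2
    have e : q - x = lam • (v - v') := by
      rw [smul_sub, sub_eq_sub_iff_add_eq_add, ← hqv, add_comm]
    have e' : x - q = -(lam • (v - v')) := by rw [← e]; module
    rw [e, inner_smul_right] at h1
    rw [e', inner_neg_right, inner_smul_right] at h2
    have h3 : lam * ‖v - v'‖ ^ 2 ≤ 0 := by
      rw [← real_inner_self_eq_norm_sq, inner_sub_left]
      linarith
    have h4 : v = v' := by
      have := nonpos_of_mul_nonpos_right h3 hlam0
      rw [← sub_eq_zero, ← norm_eq_zero, ← sq_eq_zero_iff]
      exact le_antisymm this (sq_nonneg _)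
    have h5 : q = x := by
      rw [h4, sub_self, smul_zero, sub_eq_zero] at e
      exact e
    exact ⟨b, by rwa [h4, ← h5]⟩
  have hball : ∀ x ∈ Metric.ball xbar κ, x ∈ Metric.closedBall xbar ε := fun x hx =>
    Metric.ball_subset_closedBall (Metric.ball_subset_ball (min_le_left _ _) hx)
  refine ⟨Metric.ball xbar κ, Metric.ball vbar κ, Metric.isOpen_ball, convex_ball _ _,
    Metric.mem_ball_self hκ0, Metric.isOpen_ball, convex_ball _ _, Metric.mem_ball_self hκ0,
    affineSup S, ε, hε, fun x _ => hψbot x, (lowerSemicontinuous_affineSup S).lowerSemicontinuousOn _,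
    isConvexFunOn_affineSup S (convex_ball _ _), fun x hx => hψφ x (hball x hx),
    fun x hx v hv => ⟨fun ⟨hlt, hsub⟩ => ?_, fun hsub => ?_⟩, fun x hx v hv hsub => ?_⟩
  · have ha := (EReal.coe_toReal hsub.1 hsub.2.1).symm
    refine hψsub x v (φ x).toReal ⟨mem_closedBall_iff_norm.1 (hball x hx), ?_, hsub, ha, ?_⟩
    · exact (mem_ball_iff_norm.1 hv).le.trans (min_le_left _ _)
    · rw [ha, hp] at hlt
      exact_mod_cast hlt
  · obtain ⟨a, ha⟩ := hrev x hx v hv hsub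
    refine ⟨?_, ha.2.2.1⟩
    rw [ha.2.2.2.1, hp]
    exact_mod_cast ha.2.2.2.2
  · obtain ⟨a, ha⟩ := hrev x hx v hv hsub
    rw [ha.2.2.2.1, hψS x v a ha]

theorem theorem3p2 (n : ℕ) (φ : RSpace n → EReal) (xbar vbar : RSpace n)
    (hlsc : LowerSemicontinuous φ) (hpb : IsProxBounded φ)
    (hx : φ xbar < ⊤) (hv : vbar ∈ limitingSubdifferential φ xbar) :
    IsVariationallyConvexAt φ xbar vbar ↔
      (IsProxRegularAt φ xbar vbar ∧
        ∀ᶠ lam : ℝ in 𝓝[>] 0,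
          IsLocallyConvexAround (moreauEnvelope lam φ) (xbar + lam • vbar)) := by
  constructor
  · intro h
    have h' := h.hasLocalSubgradientInequality
    exact ⟨h'.isProxRegularAt, h'.eventually_isLocallyConvexAround hlsc hpb hv⟩
  · rintro ⟨hreg, hconv⟩
    exact (hreg.hasLocalSubgradientInequality hpb (EReal.coe_toReal hx.ne hv.2.1).symm
      hconv).isVariationallyConvexAt hlsc hpb hv
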